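/- Let $f\in C^1(\mathbb{R}^N,\mathbb{R}^N)$, $g\in C^1(\mathbb{R}^N,\mathbb{R}^{N\times M})$ and $h\in C^1(\mathbb{R}^N,\mathbb{R})$ with $f(0)=0$, $h(0)=0$ and $h(x)>0$ for all $x\neq 0$, and let $R\in\mathbb{R}^{M\times M}$ be symmetric positive definite; write $\|u\|_R:=\sqrt{\langle u,Ru\rangle}$. For $x\in\mathbb{R}^N$ and $\mathbf{u}\in L^\infty([0,\infty);\mathbb{R}^M)$ let $\mathbf{x}_{\mathbf{u}}(\cdot;x)$ be the Carathéodory solution of $\dot{\mathbf{x}}=f(\mathbf{x})+g(\mathbf{x})\mathbf{u}(t)$, $\mathbf{x}(0)=x$, and set $$J_\infty(x,\mathbf{u}):=\int_0^\infty h(\mathbf{x}_{\mathbf{u}}(t;x))+\langle \mathbf{u}(t),R\,\mathbf{u}(t)\rangle\,dt,$$ with $J_\infty(x,\mathbf{u}):=+\infty$ if the solution blows up in finite time. Let $v^*(x):=\inf_{\mathbf{u}\in L^\infty([0,\infty);\mathbb{R}^M)}J_\infty(x,\mathbf{u})\in[0,\infty]$ be the optimal value function. Let $\Omega\subset\mathbb{R}^N$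 be a domain (open and connected) containing the origin. Suppose that $v^*$ is finite, continuously differentiable and real-analytic on $\Omega$. Let $v\in C^1(\Omega,\mathbb{R})$ be such that 1. $v(x)\ge 0$ for all $x\in\Omega$ and $v(0)=0$; 2. for all $x\in\Omega$, $$\langle f(x)+g(x)u_v(x),\nabla v(x)\rangle+h(x)+\|u_v(x)\|_R^2=0,\qquad\text{where } u_v(x):=-\tfrac12R^{-1}g(x)^{\top}\nabla v(x);$$ 3. $v$ is real-analytic on $\Omega$. Then $v(x)=v^*(x)$ for all $x\in\Omega$. -/

import Mathlib

open MeasureTheory Set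
open scoped ENNReal Gradient InnerProductSpace

namespace OptCtrl

variable {N M : ℕ}

/-- The matrix-vector product `A x`, between Euclidean spaces. -/
noncomputable def act {m n : ℕ} (A : Matrix (Fin m) (Fin n) ℝ) (x : EuclideanSpace ℝ (Fin n)) :
    EuclideanSpace ℝ (Fin m) :=
  Matrix.toEuclideanLin A x

/-- The weighted norm `‖x‖_A = √⟨x, A x⟩`. -/
noncomputable def weightedNorm {d : ℕ} (A : Matrix (Fin d) (Fin d) ℝ)
    (x : EuclideanSpace ℝ (Fin d)) : ℝ :=
  Real.sqrt ⟪x, act A x⟫_ℝ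

/-- The standing assumptions on the system data: `f`, `g`, `h` are `C¹` (the matrix-valued `g`
entrywise), `R` is symmetric positive definite, `f 0 = 0`, and `h` is positive definite. -/
structure DataAssumption
    (f : EuclideanSpace ℝ (Fin N) → EuclideanSpace ℝ (Fin N))
    (g : EuclideanSpace ℝ (Fin N) → Matrix (Fin N) (Fin M) ℝ)
    (h : EuclideanSpace ℝ (Fin N) → ℝ)
    (R : Matrix (Fin M) (Fin M) ℝ) : Prop where
  contDiff_f : ContDiff ℝ 1 f
  contDiff_g : ∀ i j, ContDiff ℝ 1 (fun x => g x i j)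
  contDiff_h : ContDiff ℝ 1 h
  symm_R : R.IsSymm
  pos_R : ∀ u : EuclideanSpace ℝ (Fin M), u ≠ 0 → 0 < ⟪u, act R u⟫_ℝ
  f_zero : f 0 = 0
  h_pos : ∀ x, x ≠ 0 → 0 < h x
  h_zero : h 0 = 0

/-- The admissible inputs `L^∞([0,∞); ℝ^M)`: measurable and essentially bounded on `[0,∞)`
(values at negative times are irrelevant everywhere below). -/
def IsAdmissible (u : ℝ → EuclideanSpace ℝ (Fin M)) : Prop :=
  MemLp u ∞ (volume.restrict (Ici (0 : ℝ)))

/-- `y` is a Carathéodory solution, on all of `[0,∞)`, of `y' = f(y) + g(y) u`, `y(0) = x`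
(in integrated form). -/
structure IsTrajectory
    (f : EuclideanSpace ℝ (Fin N) → EuclideanSpace ℝ (Fin N))
    (g : EuclideanSpace ℝ (Fin N) → Matrix (Fin N) (Fin M) ℝ)
    (u : ℝ → EuclideanSpace ℝ (Fin M)) (x : EuclideanSpace ℝ (Fin N))
    (y : ℝ → EuclideanSpace ℝ (Fin N)) : Prop where
  continuousOn : ContinuousOn y (Ici 0)
  integrable : ∀ t : ℝ, 0 ≤ t →
    IntervalIntegrable (fun s => f (y s) + act (g (y s)) (u s)) volume 0 t
  eq_integral : ∀ t : ℝ, 0 ≤ t → y t = x + ∫ s in (0 : ℝ)..t, (f (y s) + act (g (y s)) (u s))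

/-- The infinite-horizon cost `J_∞(x,u) = ∫₀^∞ h(y(t)) + ⟨u(t), R u(t)⟩ dt` along the state
trajectory `y`. For `C¹` data the trajectory is unique on `[0,∞)` when it exists, so the infimum
over `y` ranges over at most one value; if the trajectory blows up in finite time, no global `y`
exists and the value is `∞`. The running cost is nonnegative under the standing assumptions, so
that the integral makes sense in `[0,∞]`. -/
noncomputable def cost
    (f : EuclideanSpace ℝ (Fin N) → EuclideanSpace ℝ (Fin N))
    (g : EuclideanSpace ℝ (Fin N) → Matrix (Fin N) (Fin M) ℝ)
    (h : EuclideanSpace ℝ (Fin N) → ℝ)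
    (R : Matrix (Fin M) (Fin M) ℝ)
    (x : EuclideanSpace ℝ (Fin N)) (u : ℝ → EuclideanSpace ℝ (Fin M)) : ℝ≥0∞ :=
  ⨅ (y : ℝ → EuclideanSpace ℝ (Fin N)) (_ : IsTrajectory f g u x y),
    ∫⁻ t in Ici (0 : ℝ), ENNReal.ofReal (h (y t) + ⟪u t, act R (u t)⟫_ℝ)

/-- The optimal value function `v*(x) = inf_u J_∞(x,u)`, with values in `[0,∞]`. -/
noncomputable def optimalValue
    (f : EuclideanSpace ℝ (Fin N) → EuclideanSpace ℝ (Fin N))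
    (g : EuclideanSpace ℝ (Fin N) → Matrix (Fin N) (Fin M) ℝ)
    (h : EuclideanSpace ℝ (Fin N) → ℝ)
    (R : Matrix (Fin M) (Fin M) ℝ)
    (x : EuclideanSpace ℝ (Fin N)) : ℝ≥0∞ :=
  ⨅ (u : ℝ → EuclideanSpace ℝ (Fin M)) (_ : IsAdmissible u), cost f g h R x u

/-- The feedback `u_v(x) = -½ R⁻¹ g(x)ᵀ ∇v(x)`. -/
noncomputable def feedback
    (g : EuclideanSpace ℝ (Fin N) → Matrix (Fin N) (Fin M) ℝ)
    (R : Matrix (Fin M) (Fin M) ℝ)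
    (v : EuclideanSpace ℝ (Fin N) → ℝ) (x : EuclideanSpace ℝ (Fin N)) :
    EuclideanSpace ℝ (Fin M) :=
  -(1 / 2 : ℝ) • act R⁻¹ (act (g x).transpose (∇ v x))

end OptCtrl

/-! Both functions are analytic on the connected set Ω, so it suffices to show that they agree near
the origin.

Lower bound (`eventually_le_optimalValue`): completing the square in the HJB equation shows that
along any trajectory in Ω, `v` decreases no faster than cost accumulates. A trajectory confined to a
small ball with finite cost must come arbitrarily close to 0, since `h` is bounded below away from 0
there; as `v` is continuous with `v 0 = 0`, its cost is at least `v x`. A trajectory that leaves the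
ball crosses an annulus on which running cost dominates speed, so it pays at least a fixed κ, and `v
x < κ` for `x` near 0.

Upper bound (`eventually_optimalValue_le`): the feedback attains equality in the square, so the
closed loop costs `v x - v (y T) ≤ v x` up to time T. It exists for all time because `v` is positive
off 0 and nonincreasing along it, which traps orbits starting near 0. Analyticity of `v` makes the
feedback `C¹`. -/

namespace OptCtrl

/-! ### The matrix action -/

theorem act_apply {m n : ℕ} (A : Matrix (Fin m) (Fin n) ℝ) (x : EuclideanSpace ℝ (Fin n))
    (i : Fin m) : act A x i = ∑ j, A i j * x j := by
  simp [act, Matrix.toLpLin_apply, Matrix.mulVec, dotProduct]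

theorem act_sub {m n : ℕ} (A : Matrix (Fin m) (Fin n) ℝ) (x y : EuclideanSpace ℝ (Fin n)) :
    act A (x - y) = act A x - act A y := map_sub _ x y

theorem act_smul {m n : ℕ} (A : Matrix (Fin m) (Fin n) ℝ) (c : ℝ) (x : EuclideanSpace ℝ (Fin n)) :
    act A (c • x) = c • act A x := map_smul _ c x

theorem act_mul {l m n : ℕ} (A : Matrix (Fin l) (Fin m) ℝ) (B : Matrix (Fin m) (Fin n) ℝ)
    (x : EuclideanSpace ℝ (Fin n)) : act (A * B) x = act A (act B x) := by
  simp [act, Matrix.toLpLin_apply, Matrix.mulVec_mulVec]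

theorem act_one {n : ℕ} (x : EuclideanSpace ℝ (Fin n)) : act 1 x = x := by
  simp [act]

theorem inner_act_transpose {m n : ℕ} (A : Matrix (Fin m) (Fin n) ℝ)
    (x : EuclideanSpace ℝ (Fin n)) (y : EuclideanSpace ℝ (Fin m)) :
    ⟪x, act A.transpose y⟫_ℝ = ⟪act A x, y⟫_ℝ := by
  have := Matrix.toEuclideanLin_conjTranspose_eq_adjoint A
  rw [Matrix.conjTranspose_eq_transpose_of_trivial] at this
  unfold act
  rw [this, LinearMap.adjoint_inner_right]

theorem ContDiffOn.act {m n : ℕ} {X : Type*} [NormedAddCommGroup X] [NormedSpace ℝ X]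
    {A : X → Matrix (Fin m) (Fin n) ℝ} {w : X → EuclideanSpace ℝ (Fin n)} {s : Set X}
    (hA : ∀ i j, ContDiffOn ℝ 1 (fun x => A x i j) s) (hw : ContDiffOn ℝ 1 w s) :
    ContDiffOn ℝ 1 (fun x => act (A x) (w x)) s := by
  rw [contDiffOn_euclidean] at hw ⊢
  intro i
  simp only [act_apply]
  exact ContDiffOn.sum fun j _ => (hA i j).mul (hw j)

theorem continuous_act {m n : ℕ} (A : Matrix (Fin m) (Fin n) ℝ) : Continuous (act A) :=
  LinearMap.continuous_of_finiteDimensional _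

/-- A continuous family of matrices is uniformly bounded on a compact set. -/
theorem exists_norm_act_le {m n : ℕ} {X : Type*} [TopologicalSpace X]
    {A : X → Matrix (Fin m) (Fin n) ℝ} {s : Set X} (hs : IsCompact s)
    (hA : ∀ i j, Continuous fun x => A x i j) :
    ∃ C, 0 ≤ C ∧ ∀ x ∈ s, ∀ w, ‖act (A x) w‖ ≤ C * ‖w‖ := by
  let T : Matrix (Fin m) (Fin n) ℝ →ₗ[ℝ]
      (EuclideanSpace ℝ (Fin n) →L[ℝ] EuclideanSpace ℝ (Fin m)) :=
    LinearMap.toContinuousLinearMap.toLinearMap ∘ₗ Matrix.toEuclideanLin.toLinearMap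
  have hT : Continuous T := LinearMap.continuous_of_finiteDimensional T
  have hA' : Continuous A := continuous_matrix hA
  obtain ⟨C, hC⟩ := hs.exists_bound_of_continuousOn (hT.comp hA').continuousOn
  refine ⟨max C 0, le_max_right _ _, fun x hx w => ?_⟩
  exact ((T (A x)).le_opNorm w).trans
    (mul_le_mul_of_nonneg_right ((hC x hx).trans (le_max_left _ _)) (norm_nonneg w))

variable {N M : ℕ}
  {f : EuclideanSpace ℝ (Fin N) → EuclideanSpace ℝ (Fin N)}
  {g : EuclideanSpace ℝ (Fin N) → Matrix (Fin N) (Fin M) ℝ}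
  {h : EuclideanSpace ℝ (Fin N) → ℝ}
  {R : Matrix (Fin M) (Fin M) ℝ}

/-! ### Coercivity of the control cost and the Hamiltonian -/

namespace DataAssumption

theorem quad_nonneg (hd : DataAssumption f g h R) (u : EuclideanSpace ℝ (Fin M)) :
    0 ≤ ⟪u, act R u⟫_ℝ := by
  rcases eq_or_ne u 0 with rfl | hu
  · simp
  · exact (hd.pos_R u hu).le

theorem h_nonneg (hd : DataAssumption f g h R) (x : EuclideanSpace ℝ (Fin N)) : 0 ≤ h x := by
  rcases eq_or_ne x 0 with rfl | hx
  · exact hd.h_zero.ge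
  · exact (hd.h_pos x hx).le

theorem weightedNorm_sq (hd : DataAssumption f g h R) (u : EuclideanSpace ℝ (Fin M)) :
    weightedNorm R u ^ 2 = ⟪u, act R u⟫_ℝ :=
  Real.sq_sqrt (hd.quad_nonneg u)

theorem exists_quad_coercive (hd : DataAssumption f g h R) :
    ∃ c, 0 < c ∧ ∀ u, c * ‖u‖ ^ 2 ≤ ⟪u, act R u⟫_ℝ := by
  obtain ⟨c, hc, hcu⟩ := (isCompact_sphere (0 : EuclideanSpace ℝ (Fin M)) 1).exists_forall_le'
    (f := fun u => ⟪u, act R u⟫_ℝ) (a := 0)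
    (continuous_id.inner (continuous_act R)).continuousOn
    (fun u hu => hd.pos_R u (by rintro rfl; simp at hu))
  refine ⟨c, hc, fun u => ?_⟩
  rcases eq_or_ne u 0 with rfl | hu
  · simp
  · have hn : 0 < ‖u‖ := norm_pos_iff.mpr hu
    have := hcu (‖u‖⁻¹ • u) (by simp [norm_smul, hn.ne'])
    rw [act_smul, inner_smul_left, inner_smul_right] at this
    simp only [conj_trivial] at this
    calc c * ‖u‖ ^ 2 ≤ (‖u‖⁻¹ * (‖u‖⁻¹ * ⟪u, act R u⟫_ℝ)) * ‖u‖ ^ 2 := by gcongr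
      _ = ⟪u, act R u⟫_ℝ := by field_simp

theorem det_ne_zero (hd : DataAssumption f g h R) : R.det ≠ 0 := by
  intro h0
  obtain ⟨w, hw, hRw⟩ := Matrix.exists_mulVec_eq_zero_iff.mpr h0
  have := hd.pos_R (WithLp.toLp 2 w) (by simpa using hw)
  simp [act, Matrix.toLpLin_apply, hRw] at this

theorem act_feedback (hd : DataAssumption f g h R) (v : EuclideanSpace ℝ (Fin N) → ℝ)
    (x : EuclideanSpace ℝ (Fin N)) :
    act R (feedback g R v x) = -(1 / 2 : ℝ) • act (g x).transpose (∇ v x) := by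
  rw [feedback, act_smul, ← act_mul, Matrix.mul_nonsing_inv _ (isUnit_iff_ne_zero.mpr hd.det_ne_zero),
    act_one]

theorem inner_act_comm (hd : DataAssumption f g h R) (u w : EuclideanSpace ℝ (Fin M)) :
    ⟪u, act R w⟫_ℝ = ⟪w, act R u⟫_ℝ := by
  have := inner_act_transpose R u w
  rw [hd.symm_R.eq] at this
  rw [this, real_inner_comm]

/-- Completing the square in the Hamilton-Jacobi-Bellman equation. -/
theorem hamiltonian_nonneg (hd : DataAssumption f g h R) {v : EuclideanSpace ℝ (Fin N) → ℝ}
    {x : EuclideanSpace ℝ (Fin N)}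
    (hx : ⟪f x + act (g x) (feedback g R v x), ∇ v x⟫_ℝ + h x
        + weightedNorm R (feedback g R v x) ^ 2 = 0) (u : EuclideanSpace ℝ (Fin M)) :
    0 ≤ ⟪f x + act (g x) u, ∇ v x⟫_ℝ + (h x + ⟪u, act R u⟫_ℝ) := by
  have key : ∀ w, ⟪act (g x) w, ∇ v x⟫_ℝ = -2 * ⟪w, act R (feedback g R v x)⟫_ℝ := by
    intro w
    rw [hd.act_feedback, ← inner_act_transpose, inner_smul_right]
    ring
  -- By `key`, the Hamiltonian at `u` minus its value 0 at the feedback is exactly this square.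
  have hsq := hd.quad_nonneg (u - feedback g R v x)
  rw [act_sub, inner_sub_left, inner_sub_right, inner_sub_right,
    hd.inner_act_comm (feedback g R v x) u] at hsq
  rw [hd.weightedNorm_sq, inner_add_left, key] at hx
  rw [inner_add_left, key]
  linarith

end DataAssumption

/-! ### Absolutely continuous curves -/

/-- Used to transfer absolute continuity from a primitive of `‖F‖` to `v` along the curve. -/
theorem absolutelyContinuousOnInterval_of_dist_le {X Y : Type*} [PseudoMetricSpace X]
    [PseudoMetricSpace Y] {p : ℝ → X} {q : ℝ → Y} {a b : ℝ}
    (hq : AbsolutelyContinuousOnInterval q a b)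
    (hpq : ∀ s ∈ uIcc a b, ∀ t ∈ uIcc a b, dist (p s) (p t) ≤ dist (q s) (q t)) :
    AbsolutelyContinuousOnInterval p a b := by
  rw [absolutelyContinuousOnInterval_iff] at hq ⊢
  intro ε hε
  obtain ⟨δ, hδ, H⟩ := hq ε hε
  refine ⟨δ, hδ, fun E hE hE' => (Finset.sum_le_sum fun i hi => ?_).trans_lt (H E hE hE')⟩
  exact hpq _ (hE.1 i hi).1 _ (hE.1 i hi).2

theorem sub_eq_integral {E : Type*} [NormedAddCommGroup E] [NormedSpace ℝ E]
    {F y : ℝ → E} {x : E} {T : ℝ} (hF : IntervalIntegrable F volume 0 T) (hT : 0 ≤ T)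
    (hy : ∀ t ∈ Icc 0 T, y t = x + ∫ s in (0 : ℝ)..t, F s) {a b : ℝ} (ha : a ∈ Icc 0 T)
    (hb : b ∈ Icc 0 T) : y b - y a = ∫ s in a..b, F s := by
  have hsub : ∀ t ∈ Icc 0 T, IntervalIntegrable F volume 0 t := fun t ht =>
    hF.mono_set (by rw [uIcc_of_le ht.1, uIcc_of_le hT]; exact Icc_subset_Icc_right ht.2)
  rw [hy a ha, hy b hb, add_sub_add_left_eq_sub,
    intervalIntegral.integral_interval_sub_left (hsub b hb) (hsub a ha)]

/-- Growth of a `C¹` function along an absolutely continuous curve whose rate of decay is at most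
`ℓ`. -/
theorem ofReal_sub_le_lintegral {E : Type*} [NormedAddCommGroup E] [NormedSpace ℝ E]
    [CompleteSpace E] {F y : ℝ → E} {x : E} {T : ℝ} (hT : 0 ≤ T)
    (hF : IntervalIntegrable F volume 0 T)
    (hy : ∀ t ∈ Icc 0 T, y t = x + ∫ s in (0 : ℝ)..t, F s)
    {v : E → ℝ} {s : Set E} {K : NNReal} (hv : LipschitzOnWith K v s)
    (hvd : ∀ z ∈ s, DifferentiableAt ℝ v z) (hys : ∀ t ∈ Icc 0 T, y t ∈ s)
    {ℓ : ℝ → ℝ} (hℓ : ∀ t ∈ Icc 0 T, 0 ≤ fderiv ℝ v (y t) (F t) + ℓ t) :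
    ENNReal.ofReal (v (y 0) - v (y T)) ≤ ∫⁻ t in Ioc 0 T, ENNReal.ofReal (ℓ t) := by
  have hu : uIcc 0 T = Icc 0 T := uIcc_of_le hT
  have hΦ : AbsolutelyContinuousOnInterval (fun t => (K : ℝ) * ∫ s in (0 : ℝ)..t, ‖F s‖) 0 T :=
    (hF.norm.absolutelyContinuousOnInterval_intervalIntegral (by simp)).const_mul _
  have hac : AbsolutelyContinuousOnInterval (fun t => v (y t)) 0 T := by
    refine absolutelyContinuousOnInterval_of_dist_le hΦ fun a ha b hb => ?_
    rw [hu] at ha hb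
    wlog hab : a ≤ b generalizing a b
    · rw [dist_comm, dist_comm (_ * _)]; exact this b hb a ha (le_of_not_ge hab)
    have hsub : ∀ t ∈ Icc 0 T, IntervalIntegrable (fun s => ‖F s‖) volume 0 t := fun t ht =>
      hF.norm.mono_set (by rw [uIcc_of_le ht.1, hu]; exact Icc_subset_Icc_right ht.2)
    calc dist (v (y a)) (v (y b)) ≤ K * dist (y a) (y b) :=
          hv.dist_le_mul _ (hys a ha) _ (hys b hb)
      _ = K * ‖∫ s in a..b, F s‖ := by
          rw [dist_comm, dist_eq_norm, sub_eq_integral hF hT hy ha hb]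
      _ ≤ K * ∫ s in a..b, ‖F s‖ := by
          gcongr; exact intervalIntegral.norm_integral_le_integral_norm hab
      _ = K * ((∫ s in (0 : ℝ)..b, ‖F s‖) - ∫ s in (0 : ℝ)..a, ‖F s‖) := by
          rw [intervalIntegral.integral_interval_sub_left (hsub b hb) (hsub a ha)]
      _ ≤ _ := by
          rw [dist_comm, Real.dist_eq, ← mul_sub]; exact le_abs_self _
  have hder : ∀ᵐ t, t ∈ Ioc 0 T → -deriv (fun t => v (y t)) t ≤ ℓ t := by
    -- The integral formula for `y` holds only on `[0, T]`, so a two-sided derivative needs an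
    -- interior point.
    have hne : ∀ᵐ t : ℝ, t ≠ T := by simp [ae_iff, measure_singleton]
    filter_upwards [hF.ae_hasDerivAt_integral, hne] with t ht htT htI
    have htI' : t ∈ Icc 0 T := Ioc_subset_Icc_self htI
    have hFt := (ht (by rwa [hu]) 0 (by simp)).const_add x
    have hyt : HasDerivAt y (F t) t := by
      refine hFt.congr_of_eventuallyEq ?_
      filter_upwards [Ioo_mem_nhds htI.1 (lt_of_le_of_ne htI.2 htT)] with s hs
      exact hy s (Ioo_subset_Icc_self hs)
    have := ((hvd (y t) (hys t htI')).hasFDerivAt.comp_hasDerivAt t hyt).deriv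
    change deriv (fun t => v (y t)) t = _ at this
    rw [this]
    linarith [hℓ t htI']
  have hint := hac.intervalIntegrable_deriv
  rw [intervalIntegrable_iff_integrableOn_Ioc_of_le hT] at hint
  have hFTC := hac.integral_deriv_eq_sub
  have : v (y 0) - v (y T) = ∫ t in Ioc 0 T, -deriv (fun t => v (y t)) t := by
    rw [integral_neg, ← intervalIntegral.integral_of_le hT, hFTC]; ring
  -- Keeping only the positive part bounds the integral by a lower integral, so `ℓ` need be neither
  -- measurable nor integrable.
  rw [this, integral_eq_lintegral_pos_part_sub_lintegral_neg_part
    (f := fun t => -deriv (fun t => v (y t)) t) hint.neg]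
  refine (ENNReal.ofReal_le_ofReal (sub_le_self _ ENNReal.toReal_nonneg)).trans
    (ENNReal.ofReal_toReal_le.trans ?_)
  refine lintegral_mono_ae ((ae_restrict_iff' measurableSet_Ioc).mpr ?_)
  filter_upwards [hder] with t ht htI
  exact ENNReal.ofReal_le_ofReal (ht htI)

end OptCtrl

namespace OptCtrl

variable {N M : ℕ}
  {f : EuclideanSpace ℝ (Fin N) → EuclideanSpace ℝ (Fin N)}
  {g : EuclideanSpace ℝ (Fin N) → Matrix (Fin N) (Fin M) ℝ}
  {h : EuclideanSpace ℝ (Fin N) → ℝ}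
  {R : Matrix (Fin M) (Fin M) ℝ}

/-! ### Lower bound for the cost -/

theorem IsTrajectory.apply_zero {u : ℝ → EuclideanSpace ℝ (Fin M)} {x : EuclideanSpace ℝ (Fin N)}
    {y : ℝ → EuclideanSpace ℝ (Fin N)} (hy : IsTrajectory f g u x y) : y 0 = x := by
  simpa using hy.eq_integral 0 le_rfl

/-- The local hypotheses on a candidate value function: it is a nonnegative `C¹` solution of the
Hamilton-Jacobi-Bellman equation on `Ω` that vanishes at the origin. -/
structure IsHJBSolution
    (f : EuclideanSpace ℝ (Fin N) → EuclideanSpace ℝ (Fin N))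
    (g : EuclideanSpace ℝ (Fin N) → Matrix (Fin N) (Fin M) ℝ)
    (h : EuclideanSpace ℝ (Fin N) → ℝ) (R : Matrix (Fin M) (Fin M) ℝ)
    (v : EuclideanSpace ℝ (Fin N) → ℝ) (Ω : Set (EuclideanSpace ℝ (Fin N))) : Prop where
  isOpen : IsOpen Ω
  zero_mem : (0 : EuclideanSpace ℝ (Fin N)) ∈ Ω
  contDiffOn : ContDiffOn ℝ 1 v Ω
  nonneg : ∀ x ∈ Ω, 0 ≤ v x
  map_zero : v 0 = 0
  hjb : ∀ x ∈ Ω, ⟪f x + act (g x) (feedback g R v x), ∇ v x⟫_ℝ + h x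
        + weightedNorm R (feedback g R v x) ^ 2 = 0

theorem inner_gradient_eq_fderiv {v : EuclideanSpace ℝ (Fin N) → ℝ}
    (x w : EuclideanSpace ℝ (Fin N)) : ⟪w, ∇ v x⟫_ℝ = fderiv ℝ v x w := by
  rw [real_inner_comm, gradient, InnerProductSpace.toDual_symm_apply]

namespace IsHJBSolution

variable {v : EuclideanSpace ℝ (Fin N) → ℝ} {Ω : Set (EuclideanSpace ℝ (Fin N))}

theorem differentiableAt (hv : IsHJBSolution f g h R v Ω) {x : EuclideanSpace ℝ (Fin N)}
    (hx : x ∈ Ω) : DifferentiableAt ℝ v x :=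
  (hv.contDiffOn.differentiableOn one_ne_zero).differentiableAt (hv.isOpen.mem_nhds hx)

theorem continuousAt (hv : IsHJBSolution f g h R v Ω) {x : EuclideanSpace ℝ (Fin N)}
    (hx : x ∈ Ω) : ContinuousAt v x :=
  (hv.differentiableAt hx).continuousAt

theorem exists_lipschitzOnWith (hv : IsHJBSolution f g h R v Ω) {r : ℝ}
    (hr : Metric.closedBall 0 r ⊆ Ω) : ∃ K, LipschitzOnWith K v (Metric.closedBall 0 r) :=
  (hv.contDiffOn.mono hr).exists_lipschitzOnWith one_ne_zero (convex_closedBall _ _)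
    (isCompact_closedBall _ _)

/-- Integrates `hamiltonian_nonneg` along `y`; the compact convex ball supplies the Lipschitz
constant of `v`. -/
theorem ofReal_sub_le_cost (hv : IsHJBSolution f g h R v Ω) (hd : DataAssumption f g h R)
    {r : ℝ} (hr : Metric.closedBall 0 r ⊆ Ω) {u : ℝ → EuclideanSpace ℝ (Fin M)}
    {x : EuclideanSpace ℝ (Fin N)} {y : ℝ → EuclideanSpace ℝ (Fin N)}
    (hy : IsTrajectory f g u x y) {T : ℝ} (hT : 0 ≤ T)
    (hyr : ∀ t ∈ Icc 0 T, y t ∈ Metric.closedBall 0 r) :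
    ENNReal.ofReal (v x - v (y T)) ≤
      ∫⁻ t in Ici (0 : ℝ), ENNReal.ofReal (h (y t) + ⟪u t, act R (u t)⟫_ℝ) := by
  obtain ⟨K, hK⟩ := hv.exists_lipschitzOnWith hr
  rw [← hy.apply_zero]
  refine (ofReal_sub_le_lintegral hT (hy.integrable T hT) (fun t ht => hy.eq_integral t ht.1) hK
    (fun z hz => hv.differentiableAt (hr hz)) hyr fun t ht => ?_).trans
    (lintegral_mono_set (Ioc_subset_Icc_self.trans Icc_subset_Ici_self))
  rw [← inner_gradient_eq_fderiv]
  exact hd.hamiltonian_nonneg (hv.hjb _ (hr (hyr t ht))) (u t)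

theorem ofReal_le_cost_of_forall_mem (hv : IsHJBSolution f g h R v Ω)
    (hd : DataAssumption f g h R) {r : ℝ} (hr : Metric.closedBall 0 r ⊆ Ω)
    {u : ℝ → EuclideanSpace ℝ (Fin M)} {x : EuclideanSpace ℝ (Fin N)}
    {y : ℝ → EuclideanSpace ℝ (Fin N)} (hy : IsTrajectory f g u x y)
    (hyr : ∀ t, 0 ≤ t → y t ∈ Metric.closedBall 0 r) :
    ENNReal.ofReal (v x) ≤
      ∫⁻ t in Ici (0 : ℝ), ENNReal.ofReal (h (y t) + ⟪u t, act R (u t)⟫_ℝ) := by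
  by_contra! hlt
  set J := ∫⁻ t in Ici (0 : ℝ), ENNReal.ofReal (h (y t) + ⟪u t, act R (u t)⟫_ℝ) with hJ
  have hJtop : J ≠ ∞ := (hlt.trans ENNReal.ofReal_lt_top).ne
  have hj : J.toReal < v x := ENNReal.toReal_lt_of_lt_ofReal hlt
  -- Reaching this neighbourhood of 0 at some time T would give `v x - v (y T) > J`, contradicting
  -- `ofReal_sub_le_cost`.
  have hev := (hv.continuousAt hv.zero_mem).eventually_lt_const
    (u := v x - J.toReal) (by rw [hv.map_zero]; linarith)
  obtain ⟨δ, hδ, hball⟩ := Metric.eventually_nhds_iff_ball.mp hev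
  by_cases hT : ∃ T, 0 ≤ T ∧ y T ∈ Metric.ball 0 δ
  · obtain ⟨T, hT0, hT⟩ := hT
    have h1 := hv.ofReal_sub_le_cost hd hr hy hT0 fun t ht => hyr t ht.1
    rw [← hJ, ← ENNReal.ofReal_toReal hJtop, ENNReal.ofReal_le_ofReal_iff ENNReal.toReal_nonneg] at h1
    linarith [hball _ hT]
  · push Not at hT
    -- Otherwise `y` avoids the ball of radius δ forever, so `h ≥ η > 0` along it and the cost is
    -- infinite.
    obtain ⟨η, hη, hηh⟩ := ((isCompact_closedBall (0 : EuclideanSpace ℝ (Fin N)) r).diff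
      Metric.isOpen_ball).exists_forall_le' (f := h) (a := 0) hd.contDiff_h.continuous.continuousOn
      (fun z hz => hd.h_pos z (by rintro rfl; exact hz.2 (Metric.mem_ball_self hδ)))
    refine hJtop (top_le_iff.mp ?_)
    calc (∞ : ℝ≥0∞) = ∫⁻ _ in Ici (0 : ℝ), ENNReal.ofReal η := by
          simp [ENNReal.mul_top, hη]
      _ ≤ J := by
          refine setLIntegral_mono' measurableSet_Ici fun t ht => ENNReal.ofReal_le_ofReal ?_
          linarith [hηh (y t) ⟨hyr t ht, hT t ht⟩, hd.quad_nonneg (u t)]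

end IsHJBSolution

/-- On an annulus the running cost dominates the speed. -/
theorem DataAssumption.exists_norm_le_mul (hd : DataAssumption f g h R) {r : ℝ} (hr : 0 < r) :
    ∃ K, 0 < K ∧ ∀ z : EuclideanSpace ℝ (Fin N), r / 2 ≤ ‖z‖ → ‖z‖ ≤ r →
      ∀ w, ‖f z + act (g z) w‖ ≤ K * (h z + ⟪w, act R w⟫_ℝ) := by
  have hB := isCompact_closedBall (0 : EuclideanSpace ℝ (Fin N)) r
  obtain ⟨A, hA⟩ := hB.exists_bound_of_continuousOn hd.contDiff_f.continuous.continuousOn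
  obtain ⟨C, hC0, hC⟩ := exists_norm_act_le hB fun i j => (hd.contDiff_g i j).continuous
  obtain ⟨c, hc, hcR⟩ := hd.exists_quad_coercive
  obtain ⟨η, hη, hηh⟩ := (hB.diff (Metric.isOpen_ball (x := 0) (ε := r / 2))).exists_forall_le'
    (f := h) (a := 0) hd.contDiff_h.continuous.continuousOn
    (fun z hz => hd.h_pos z (by rintro rfl; exact hz.2 (Metric.mem_ball_self (half_pos hr))))
  have hA0 : 0 ≤ A := (norm_nonneg _).trans (hA 0 (Metric.mem_closedBall_self hr.le))
  -- The speed is at most `A + C * ‖w‖ ≤ (A + C) + C * ‖w‖ ^ 2`; `h ≥ η` absorbs the first term and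
  -- coercivity of `R` the second. The `+ 1` only ensures positivity.
  refine ⟨(A + C) / η + C / c + 1, by positivity, fun z hz1 hz2 w => ?_⟩
  have hz : z ∈ Metric.closedBall 0 r := by simpa using hz2
  have hhz : η ≤ h z := hηh z ⟨hz, by simpa using hz1⟩
  have hw : ‖w‖ ≤ 1 + ‖w‖ ^ 2 := by nlinarith [sq_nonneg (‖w‖ - 1)]
  have hq := hd.quad_nonneg w
  have e1 : A + C ≤ (A + C) / η * (h z + ⟪w, act R w⟫_ℝ) := by
    calc A + C = (A + C) / η * η := by field_simp
      _ ≤ _ := by gcongr; linarith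
  have e2 : C * ‖w‖ ^ 2 ≤ C / c * (h z + ⟪w, act R w⟫_ℝ) := by
    calc C * ‖w‖ ^ 2 = C / c * (c * ‖w‖ ^ 2) := by field_simp
      _ ≤ _ := by gcongr; linarith [hcR w]
  calc ‖f z + act (g z) w‖ ≤ A + C * ‖w‖ :=
        (norm_add_le _ _).trans (add_le_add (hA z hz) (hC z hz w))
    _ ≤ A + C * (1 + ‖w‖ ^ 2) := by gcongr
    _ ≤ _ := by linarith

/-- Escaping from a ball costs at least a fixed positive amount. -/
theorem DataAssumption.exists_escape_cost (hd : DataAssumption f g h R) {r : ℝ} (hr : 0 < r) :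
    ∃ κ, 0 < κ ∧ ∀ (u : ℝ → EuclideanSpace ℝ (Fin M)) (x : EuclideanSpace ℝ (Fin N))
      (y : ℝ → EuclideanSpace ℝ (Fin N)), IsTrajectory f g u x y → ‖x‖ ≤ r / 2 →
      (∃ t, 0 ≤ t ∧ r ≤ ‖y t‖) → ENNReal.ofReal κ ≤
        ∫⁻ t in Ici (0 : ℝ), ENNReal.ofReal (h (y t) + ⟪u t, act R (u t)⟫_ℝ) := by
  obtain ⟨K, hK, hKb⟩ := hd.exists_norm_le_mul hr
  -- The width of the annulus divided by the speed-to-cost ratio.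
  refine ⟨r / 2 / K, by positivity, fun u x y hy hx ⟨t₁, ht₁, hrt₁⟩ => ?_⟩
  have hcont : ∀ T, ContinuousOn (fun t => ‖y t‖) (Icc 0 T) := fun T =>
    (hy.continuousOn.mono Icc_subset_Ici_self).norm
  -- `b` is the first time with norm at least `r`, and `a` the last time before it with norm at most
  -- `r / 2`; in between, `y` lies in the annulus.
  obtain ⟨b, ⟨⟨hb0, hb1⟩, hbr⟩, hbmin⟩ :=
    ((isCompact_Icc (a := (0 : ℝ)) (b := t₁)).of_isClosed_subset
      ((hcont t₁).preimage_isClosed_of_isClosed isClosed_Icc (isClosed_Ici (a := r)))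
      inter_subset_left).exists_isLeast ⟨t₁, ⟨ht₁, le_rfl⟩, hrt₁⟩
  obtain ⟨a, ⟨⟨ha0, hab⟩, har⟩, hamax⟩ :=
    ((isCompact_Icc (a := (0 : ℝ)) (b := b)).of_isClosed_subset
      ((hcont b).preimage_isClosed_of_isClosed isClosed_Icc (isClosed_Iic (a := r / 2)))
      inter_subset_left).exists_isGreatest ⟨0, ⟨le_rfl, hb0⟩, by simpa [hy.apply_zero] using hx⟩
  simp only [mem_preimage, mem_Ici, mem_Iic] at hbr har
  have hann : ∀ t ∈ Ioo a b, r / 2 ≤ ‖y t‖ ∧ ‖y t‖ ≤ r := by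
    intro t ht
    constructor
    · by_contra! hlt
      exact ht.1.not_ge (hamax ⟨⟨ha0.trans ht.1.le, ht.2.le⟩, hlt.le⟩)
    · by_contra! hlt
      exact ht.2.not_ge (hbmin ⟨⟨ha0.trans ht.1.le, ht.2.le.trans hb1⟩, hlt.le⟩)
  have hdiff : y b - y a = ∫ s in a..b, (f (y s) + act (g (y s)) (u s)) :=
    sub_eq_integral (hy.integrable b hb0) hb0 (fun t ht => hy.eq_integral t ht.1) ⟨ha0, hab⟩
      ⟨hb0, le_rfl⟩
  rw [ENNReal.ofReal_div_of_pos hK]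
  refine ENNReal.div_le_of_le_mul' ?_
  calc ENNReal.ofReal (r / 2) ≤ ENNReal.ofReal ‖y b - y a‖ :=
        ENNReal.ofReal_le_ofReal (by linarith [norm_sub_norm_le (y b) (y a)])
    _ = ‖∫ s in Ioc a b, (f (y s) + act (g (y s)) (u s))‖ₑ := by
        rw [hdiff, intervalIntegral.integral_of_le hab, ofReal_norm]
    _ ≤ ∫⁻ s in Ioc a b, ‖f (y s) + act (g (y s)) (u s)‖ₑ := enorm_integral_le_lintegral_enorm _
    _ = ∫⁻ s in Ioo a b, ‖f (y s) + act (g (y s)) (u s)‖ₑ := by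
        rw [restrict_Ioo_eq_restrict_Ioc]
    _ ≤ ∫⁻ s in Ioo a b, ENNReal.ofReal K *
          ENNReal.ofReal (h (y s) + ⟪u s, act R (u s)⟫_ℝ) := by
        refine setLIntegral_mono' measurableSet_Ioo fun s hs => ?_
        rw [← ENNReal.ofReal_mul hK.le, ← ofReal_norm]
        exact ENNReal.ofReal_le_ofReal (hKb _ (hann s hs).1 (hann s hs).2 _)
    _ = ENNReal.ofReal K * ∫⁻ s in Ioo a b,
          ENNReal.ofReal (h (y s) + ⟪u s, act R (u s)⟫_ℝ) :=
        lintegral_const_mul' _ _ ENNReal.ofReal_ne_top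
    _ ≤ _ := by
        gcongr
        exact fun s hs => ha0.trans hs.1.le

theorem IsHJBSolution.eventually_le_optimalValue {v : EuclideanSpace ℝ (Fin N) → ℝ}
    {Ω : Set (EuclideanSpace ℝ (Fin N))} (hv : IsHJBSolution f g h R v Ω)
    (hd : DataAssumption f g h R) :
    ∀ᶠ x in nhds 0, ENNReal.ofReal (v x) ≤ optimalValue f g h R x := by
  obtain ⟨r, hr, hrΩ⟩ := Metric.nhds_basis_closedBall.mem_iff.mp (hv.isOpen.mem_nhds hv.zero_mem)
  obtain ⟨κ, hκ, hesc⟩ := hd.exists_escape_cost hr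
  filter_upwards [(hv.continuousAt hv.zero_mem).eventually_lt_const (u := κ)
    (by rwa [hv.map_zero]), Metric.closedBall_mem_nhds 0 (half_pos hr)] with x hxκ hxr
  refine le_iInf₂ fun u _ => le_iInf₂ fun y hy => ?_
  by_cases hexit : ∃ t, 0 ≤ t ∧ r ≤ ‖y t‖
  · exact (ENNReal.ofReal_le_ofReal hxκ.le).trans (hesc u x y hy (by simpa using hxr) hexit)
  · push Not at hexit
    exact hv.ofReal_le_cost_of_forall_mem hd hrΩ hy
      fun t ht => by simpa using (hexit t ht).le

end OptCtrl

namespace OptCtrl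

/-! ### Closed-loop trajectories -/

/-- A bounded Lipschitz vector field has a solution on `[0,∞)` from every initial value. -/
theorem exists_forall_hasDerivWithinAt_Ici {E : Type*} [NormedAddCommGroup E] [NormedSpace ℝ E]
    [CompleteSpace E] {F : E → E} {K : NNReal} (hF : LipschitzWith K F) {C : ℝ}
    (hC : ∀ z, ‖F z‖ ≤ C) (x : E) :
    ∃ y : ℝ → E, y 0 = x ∧ ∀ t, 0 ≤ t → HasDerivWithinAt y (F (y t)) (Ici 0) t := by
  have hC0 : 0 ≤ C := (norm_nonneg _).trans (hC x)
  have hex : ∀ T : ℝ, ∃ α : ℝ → E, 0 ≤ T → α 0 = x ∧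
      ∀ t ∈ Icc 0 T, HasDerivWithinAt α (F (α t)) (Icc 0 T) t := by
    intro T
    by_cases hT : 0 ≤ T
    · have hPL : IsPicardLindelof (fun _ => F) (⟨0, le_rfl, hT⟩ : Icc 0 T) x
          (C.toNNReal * T.toNNReal) 0 C.toNNReal K := by
        refine .of_time_independent (fun z _ => ?_) hF.lipschitzOnWith ?_
        · rw [Real.coe_toNNReal _ hC0]; exact hC z
        · simp [hT]
      obtain ⟨α, hα0, hα⟩ := hPL.exists_eq_forall_mem_Icc_hasDerivWithinAt₀
      exact ⟨α, fun _ => ⟨hα0, hα⟩⟩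
    · exact ⟨fun _ => x, fun h => absurd h hT⟩
  choose α hα using hex
  have huniq : ∀ S T, 0 ≤ S → S ≤ T → EqOn (α S) (α T) (Icc 0 S) := by
    intro S T hS hST
    have hder : ∀ T', S ≤ T' → ∀ t ∈ Ico 0 S, HasDerivWithinAt (α T') (F (α T' t)) (Ici t) t := by
      intro T' hT' t ht
      refine ((hα T' (hS.trans hT')).2 t ⟨ht.1, ht.2.le.trans hT'⟩).mono_of_mem_nhdsWithin ?_
      exact Icc_mem_nhdsGE_of_mem ⟨ht.1, ht.2.trans_le hT'⟩
    have hcont : ∀ T', S ≤ T' → ContinuousOn (α T') (Icc 0 S) := fun T' hT' =>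
      ContinuousOn.mono (fun t ht => ((hα T' (hS.trans hT')).2 t ht).continuousWithinAt)
        (Icc_subset_Icc_right hT')
    exact ODE_solution_unique_of_mem_Icc_right (v := fun _ => F) (s := fun _ => univ) (K := K)
      (fun _ _ => hF.lipschitzOnWith) (hcont S le_rfl) (hder S le_rfl) (fun _ _ => mem_univ _)
      (hcont T hST) (hder T hST) (fun _ _ => mem_univ _)
      ((hα S hS).1.trans (hα T (hS.trans hST)).1.symm)
  have heq : ∀ T t, 0 ≤ t → t ≤ T → α (t + 1) t = α T t := by
    intro T t ht htT
    rcases le_total (t + 1) T with h | h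
    · exact huniq _ _ (by linarith) h ⟨ht, by linarith⟩
    · exact (huniq T (t + 1) (ht.trans htT) h ⟨ht, htT⟩).symm
  -- Using horizon `t + 1` keeps `t` away from the right endpoint, so the derivative within `Icc 0
  -- (t + 1)` is one within `Ici 0`.
  refine ⟨fun t => α (t + 1) t, (hα (0 + 1) (by norm_num)).1, fun t ht => ?_⟩
  have h1 := (hα (t + 1) (by linarith)).2 t ⟨ht, by linarith⟩
  have h2 : HasDerivWithinAt (α (t + 1)) (F (α (t + 1) t)) (Ici 0) t := by
    refine h1.mono_of_mem_nhdsWithin ?_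
    rw [← Ici_inter_Iic]
    exact Filter.inter_mem self_mem_nhdsWithin (nhdsWithin_le_nhds (Iic_mem_nhds (by linarith)))
  refine h2.congr_of_eventuallyEq ?_ rfl
  filter_upwards [self_mem_nhdsWithin, nhdsWithin_le_nhds (Iic_mem_nhds (lt_add_one t))] with s hs hs'
  exact heq _ _ hs hs'

variable {N M : ℕ}
  {f : EuclideanSpace ℝ (Fin N) → EuclideanSpace ℝ (Fin N)}
  {g : EuclideanSpace ℝ (Fin N) → Matrix (Fin N) (Fin M) ℝ}
  {h : EuclideanSpace ℝ (Fin N) → ℝ}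
  {R : Matrix (Fin M) (Fin M) ℝ}
  {v : EuclideanSpace ℝ (Fin N) → ℝ} {Ω : Set (EuclideanSpace ℝ (Fin N))}

theorem contDiffOn_gradient (hv : ContDiffOn ℝ 1 (fderiv ℝ v) Ω) : ContDiffOn ℝ 1 (∇ v) Ω := by
  rw [contDiffOn_euclidean]
  intro i
  have : ∀ x, (∇ v x) i = fderiv ℝ v x (EuclideanSpace.single i 1) := fun x => by
    rw [← inner_gradient_eq_fderiv, EuclideanSpace.inner_single_left]
    simp
  simp only [this]
  exact hv.clm_apply contDiffOn_const

theorem DataAssumption.contDiffOn_feedback (hd : DataAssumption f g h R)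
    (hv : ContDiffOn ℝ 1 (fderiv ℝ v) Ω) : ContDiffOn ℝ 1 (feedback g R v) Ω := by
  have h1 := ContDiffOn.act (A := fun x => (g x).transpose)
    (fun i j => (hd.contDiff_g j i).contDiffOn) (contDiffOn_gradient hv)
  have h2 := ContDiffOn.act (A := fun _ => R⁻¹) (fun _ _ => contDiffOn_const) h1
  exact h2.const_smul (-(1 / 2 : ℝ))

/-- The closed-loop vector field is `C¹` if the feedback is. -/
theorem DataAssumption.contDiffOn_closedLoop (hd : DataAssumption f g h R)
    (hfb : ContDiffOn ℝ 1 (feedback g R v) Ω) :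
    ContDiffOn ℝ 1 (fun z => f z + act (g z) (feedback g R v z)) Ω :=
  hd.contDiff_f.contDiffOn.add
    (ContDiffOn.act (fun i j => (hd.contDiff_g i j).contDiffOn) hfb)

/-! ### Energy balance, invariance and the upper bound -/

namespace IsHJBSolution

/-- A zero of `v` is a local minimum, so the gradient vanishes there and the HJB equation forces `h
x ≤ 0`. -/
theorem pos (hv : IsHJBSolution f g h R v Ω) (hd : DataAssumption f g h R)
    {x : EuclideanSpace ℝ (Fin N)} (hx : x ∈ Ω) (hx0 : x ≠ 0) : 0 < v x := by
  refine (hv.nonneg x hx).lt_of_ne fun h0 => ?_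
  have hmin : IsLocalMin v x := by
    filter_upwards [hv.isOpen.mem_nhds hx] with z hz
    rw [← h0]
    exact hv.nonneg z hz
  have hgrad : ∇ v x = 0 := by simp [gradient, hmin.fderiv_eq_zero]
  have hjb := hv.hjb x hx
  rw [hgrad, inner_zero_right] at hjb
  linarith [hd.h_pos x hx0, sq_nonneg (weightedNorm R (feedback g R v x))]

/-- Energy balance along a closed-loop trajectory. -/
theorem integral_cost_eq (hv : IsHJBSolution f g h R v Ω) (hd : DataAssumption f g h R)
    (hfb : ContinuousOn (feedback g R v) Ω)
    {y : ℝ → EuclideanSpace ℝ (Fin N)} {T : ℝ} (hT : 0 ≤ T) (hyΩ : ∀ t ∈ Icc 0 T, y t ∈ Ω)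
    (hy : ∀ t ∈ Icc 0 T,
      HasDerivWithinAt y (f (y t) + act (g (y t)) (feedback g R v (y t))) (Ici 0) t) :
    IntegrableOn (fun t => h (y t) + ⟪feedback g R v (y t), act R (feedback g R v (y t))⟫_ℝ)
        (Icc 0 T) ∧
      ∫ t in (0 : ℝ)..T, (h (y t) + ⟪feedback g R v (y t), act R (feedback g R v (y t))⟫_ℝ)
        = v (y 0) - v (y T) := by
  have hyc : ContinuousOn y (Icc 0 T) := fun t ht =>
    (hy t ht).continuousWithinAt.mono Icc_subset_Ici_self
  have huc : ContinuousOn (fun t => feedback g R v (y t)) (Icc 0 T) := hfb.comp hyc hyΩ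
  have hℓ : ContinuousOn
      (fun t => h (y t) + ⟪feedback g R v (y t), act R (feedback g R v (y t))⟫_ℝ) (Icc 0 T) :=
    (hd.contDiff_h.continuous.comp_continuousOn hyc).add
      (huc.inner ((continuous_act R).comp_continuousOn huc))
  refine ⟨hℓ.integrableOn_Icc, ?_⟩
  have hvc : ContinuousOn (fun t => -v (y t)) (Icc 0 T) := fun t ht =>
    ((hv.continuousAt (hyΩ t ht)).comp_continuousWithinAt (hyc t ht)).neg
  rw [intervalIntegral.integral_eq_sub_of_hasDeriv_right_of_le hT hvc (fun t ht => ?_)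
    (hℓ.intervalIntegrable_of_Icc hT)]
  · ring
  · have htI := Ioo_subset_Icc_self ht
    have h1 := ((hv.differentiableAt (hyΩ t htI)).hasFDerivAt.comp_hasDerivWithinAt t
      ((hy t htI).mono (Ioi_subset_Ici ht.1.le))).neg
    have h2 := hv.hjb _ (hyΩ t htI)
    rw [hd.weightedNorm_sq, inner_gradient_eq_fderiv] at h2
    refine h1.congr_deriv ?_
    linarith

theorem optimalValue_le_of_closedLoop (hv : IsHJBSolution f g h R v Ω) (hd : DataAssumption f g h R)
    (hfb : ContDiffOn ℝ 1 (feedback g R v) Ω) {r : ℝ} (hr : Metric.closedBall 0 r ⊆ Ω)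
    {y : ℝ → EuclideanSpace ℝ (Fin N)} (hyr : ∀ t, 0 ≤ t → y t ∈ Metric.closedBall 0 r)
    (hy : ∀ t, 0 ≤ t →
      HasDerivWithinAt y (f (y t) + act (g (y t)) (feedback g R v (y t))) (Ici 0) t) :
    optimalValue f g h R (y 0) ≤ ENNReal.ofReal (v (y 0)) := by
  have hyc : ContinuousOn y (Ici 0) := fun t ht => (hy t ht).continuousWithinAt
  have huc : ContinuousOn (fun t => feedback g R v (y t)) (Ici 0) :=
    hfb.continuousOn.comp hyc fun t ht => hr (hyr t ht)
  obtain ⟨C, hC⟩ := (isCompact_closedBall (0 : EuclideanSpace ℝ (Fin N)) r).exists_bound_of_continuousOn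
    (hfb.continuousOn.mono hr)
  have hadm : IsAdmissible fun t => feedback g R v (y t) :=
    memLp_top_of_bound (huc.aestronglyMeasurable measurableSet_Ici) C
      ((ae_restrict_iff' measurableSet_Ici).mpr (ae_of_all _ fun t ht => hC _ (hyr t ht)))
  have hFc : ContinuousOn (fun t => f (y t) + act (g (y t)) (feedback g R v (y t))) (Ici 0) :=
    (hd.contDiffOn_closedLoop hfb).continuousOn.comp hyc fun t ht => hr (hyr t ht)
  have hint : ∀ t, 0 ≤ t → IntervalIntegrable
      (fun s => f (y s) + act (g (y s)) (feedback g R v (y s))) volume 0 t := fun t ht =>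
    (hFc.mono Icc_subset_Ici_self).intervalIntegrable_of_Icc ht
  have htraj : IsTrajectory f g (fun t => feedback g R v (y t)) (y 0) y := by
    refine ⟨hyc, hint, fun t ht => ?_⟩
    rw [intervalIntegral.integral_eq_sub_of_hasDeriv_right_of_le ht
      (hyc.mono Icc_subset_Ici_self)
      (fun s hs => (hy s hs.1.le).mono (Ioi_subset_Ici hs.1.le)) (hint t ht)]
    abel
  refine (iInf₂_le _ hadm).trans ((iInf₂_le y htraj).trans ?_)
  have hU : Ici (0 : ℝ) = ⋃ n : ℕ, Icc 0 (n : ℝ) := by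
    ext t
    simp only [mem_Ici, mem_iUnion, mem_Icc]
    exact ⟨fun ht => (exists_nat_ge t).imp fun _ hn => ⟨ht, hn⟩, fun ⟨_, ht, _⟩ => ht⟩
  rw [hU, setLIntegral_iUnion_of_directed _ (directed_of_isDirected_le fun m n hmn =>
    Icc_subset_Icc_right (Nat.cast_le.mpr hmn))]
  refine iSup_le fun n => ?_
  obtain ⟨hi, hval⟩ := hv.integral_cost_eq hd hfb.continuousOn (Nat.cast_nonneg n)
    (fun t ht => hr (hyr t ht.1)) (fun t ht => hy t ht.1)
  rw [← ofReal_integral_eq_lintegral_ofReal hi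
    (ae_of_all _ fun t => add_nonneg (hd.h_nonneg _) (hd.quad_nonneg _)),
    integral_Icc_eq_integral_Ioc, ← intervalIntegral.integral_of_le (Nat.cast_nonneg n), hval]
  -- Nonnegativity of the terminal value suffices; convergence of `y` to 0 is not needed.
  exact ENNReal.ofReal_le_ofReal (sub_le_self _ (hv.nonneg _ (hr (hyr n (Nat.cast_nonneg n)))))

/-- Small sublevel sets are invariant under the closed loop. -/
theorem eventually_exists_closedLoop (hv : IsHJBSolution f g h R v Ω)
    (hd : DataAssumption f g h R) (hfb : ContDiffOn ℝ 1 (feedback g R v) Ω) :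
    ∃ r, Metric.closedBall 0 r ⊆ Ω ∧ ∀ᶠ x in nhds 0, ∃ y : ℝ → EuclideanSpace ℝ (Fin N),
      y 0 = x ∧ ∀ t, 0 ≤ t → y t ∈ Metric.closedBall 0 r ∧
        HasDerivWithinAt y (f (y t) + act (g (y t)) (feedback g R v (y t))) (Ici 0) t := by
  obtain ⟨ρ, hρ, hρΩ⟩ := Metric.nhds_basis_closedBall.mem_iff.mp (hv.isOpen.mem_nhds hv.zero_mem)
  have hr : 0 < ρ / 2 := half_pos hρ
  have hrρ : ρ / 2 < ρ := half_lt_self hρ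
  have hrΩ : Metric.closedBall 0 (ρ / 2) ⊆ Ω :=
    (Metric.closedBall_subset_closedBall hrρ.le).trans hρΩ
  -- The cutoff makes the field globally Lipschitz and bounded without changing it on the ball of
  -- radius `ρ / 2`, where the orbit will stay.
  let χ : ContDiffBump (0 : EuclideanSpace ℝ (Fin N)) := ⟨ρ / 2, ρ, hr, hrρ⟩
  let F₀ : EuclideanSpace ℝ (Fin N) → EuclideanSpace ℝ (Fin N) :=
    fun z => f z + act (g z) (feedback g R v z)
  have hF₀ : ContDiffOn ℝ 1 F₀ Ω := hd.contDiffOn_closedLoop hfb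
  have hF : ContDiff ℝ 1 (fun z => χ z • F₀ z) := by
    refine contDiff_iff_contDiffAt.mpr fun z => ?_
    by_cases hz : z ∈ Ω
    · exact χ.contDiffAt.smul (hF₀.contDiffAt (hv.isOpen.mem_nhds hz))
    · have hz' : z ∉ tsupport χ := fun hs => hz (hρΩ (χ.tsupport_eq ▸ hs))
      refine (contDiffAt_const (c := (0 : EuclideanSpace ℝ (Fin N)))).congr_of_eventuallyEq ?_
      filter_upwards [notMem_tsupport_iff_eventuallyEq.mp hz'] with w hw
      simp [hw]
  have hFs : HasCompactSupport (fun z => χ z • F₀ z) := χ.hasCompactSupport.smul_right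
  obtain ⟨K, hK⟩ := hF.lipschitzWith_of_hasCompactSupport hFs one_ne_zero
  obtain ⟨C, hC⟩ := hF.continuous.bounded_above_of_compact_support hFs
  have hFeq : ∀ z ∈ Metric.closedBall (0 : EuclideanSpace ℝ (Fin N)) (ρ / 2),
      χ z • F₀ z = f z + act (g z) (feedback g R v z) := fun z hz => by
    rw [χ.one_of_mem_closedBall hz, one_smul]
  obtain ⟨m, hm, hmv⟩ := (isCompact_sphere (0 : EuclideanSpace ℝ (Fin N)) (ρ / 2)).exists_forall_le'
    (f := v) (a := 0)
    (hv.contDiffOn.continuousOn.mono (Metric.sphere_subset_closedBall.trans hrΩ))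
    (fun z hz => hv.pos hd (hrΩ (Metric.sphere_subset_closedBall hz))
      (by rintro rfl; simp at hz; linarith))
  refine ⟨ρ / 2, hrΩ, ?_⟩
  filter_upwards [(hv.continuousAt hv.zero_mem).eventually_lt_const (u := m)
    (by rwa [hv.map_zero]), Metric.ball_mem_nhds 0 hr] with x hxm hxr
  obtain ⟨y, hy0, hy⟩ := exists_forall_hasDerivWithinAt_Ici hK hC x
  -- At a first exit time `b`, `v (y b) ≥ m > v x`, whereas the energy balance gives `v (y b) ≤ v
  -- x`.
  have hstay : ∀ t, 0 ≤ t → ‖y t‖ < ρ / 2 := by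
    by_contra! hexit
    obtain ⟨t₁, ht₁, hrt₁⟩ := hexit
    have hyc : ContinuousOn (fun t => ‖y t‖) (Icc 0 t₁) := fun t ht =>
      ((hy t ht.1).continuousWithinAt.mono Icc_subset_Ici_self).norm
    obtain ⟨b, ⟨⟨hb0, hb1⟩, hbr⟩, hbmin⟩ :=
      ((isCompact_Icc (a := (0 : ℝ)) (b := t₁)).of_isClosed_subset
        (hyc.preimage_isClosed_of_isClosed isClosed_Icc (isClosed_Ici (a := ρ / 2)))
        inter_subset_left).exists_isLeast ⟨t₁, ⟨ht₁, le_rfl⟩, hrt₁⟩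
    simp only [mem_preimage, mem_Ici] at hbr
    have hlt : ∀ t ∈ Ico 0 b, ‖y t‖ < ρ / 2 := fun t ht => by
      by_contra! hge
      exact ht.2.not_ge (hbmin ⟨⟨ht.1, ht.2.le.trans hb1⟩, hge⟩)
    have hb : 0 < b := hb0.lt_of_ne (by rintro rfl; rw [hy0] at hbr; simp at hxr; linarith)
    have hbe : ‖y b‖ = ρ / 2 := by
      refine le_antisymm ?_ hbr
      have hcl : b ∈ closure (Ico 0 b) := by
        rw [closure_Ico hb.ne]; exact ⟨hb0, le_rfl⟩
      refine ContinuousWithinAt.closure_le hcl ((hyc b ⟨hb0, hb1⟩).mono fun t ht =>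
        ⟨ht.1, ht.2.le.trans hb1⟩) continuousWithinAt_const fun t ht => (hlt t ht).le
    have hmem : ∀ t ∈ Icc 0 b, y t ∈ Metric.closedBall 0 (ρ / 2) := fun t ht => by
      rcases ht.2.eq_or_lt with rfl | h
      · simp [hbe]
      · simpa using (hlt t ⟨ht.1, h⟩).le
    have hval := (hv.integral_cost_eq hd hfb.continuousOn hb0 (fun t ht => hrΩ (hmem t ht))
      (fun t ht => (hFeq _ (hmem t ht)) ▸ hy t ht.1)).2
    have hnn : 0 ≤ ∫ t in (0 : ℝ)..b,
        (h (y t) + ⟪feedback g R v (y t), act R (feedback g R v (y t))⟫_ℝ) :=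
      intervalIntegral.integral_nonneg hb0 fun t _ =>
        add_nonneg (hd.h_nonneg _) (hd.quad_nonneg _)
    have := hmv (y b) (by simpa using hbe)
    rw [hval, hy0] at hnn
    linarith
  refine ⟨y, hy0, fun t ht => ?_⟩
  have hmem : y t ∈ Metric.closedBall 0 (ρ / 2) := by simpa using (hstay t ht).le
  exact ⟨hmem, (hFeq _ hmem) ▸ hy t ht⟩

theorem eventually_optimalValue_le (hv : IsHJBSolution f g h R v Ω)
    (hd : DataAssumption f g h R) (hfb : ContDiffOn ℝ 1 (feedback g R v) Ω) :
    ∀ᶠ x in nhds 0, optimalValue f g h R x ≤ ENNReal.ofReal (v x) := by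
  obtain ⟨r, hr, hev⟩ := hv.eventually_exists_closedLoop hd hfb
  filter_upwards [hev] with x hx
  obtain ⟨y, rfl, hy⟩ := hx
  exact hv.optimalValue_le_of_closedLoop hd hfb hr (fun t ht => (hy t ht).1)
    fun t ht => (hy t ht).2

end IsHJBSolution

end OptCtrl

/-! ### From equality near the origin to all of Ω -/

theorem mainTheorem6 {N M : ℕ}
    (f : EuclideanSpace ℝ (Fin N) → EuclideanSpace ℝ (Fin N))
    (g : EuclideanSpace ℝ (Fin N) → Matrix (Fin N) (Fin M) ℝ)
    (h : EuclideanSpace ℝ (Fin N) → ℝ)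
    (R : Matrix (Fin M) (Fin M) ℝ)
    (hdata : OptCtrl.DataAssumption f g h R)
    (Ω : Set (EuclideanSpace ℝ (Fin N)))
    (hΩ_open : IsOpen Ω) (hΩ_conn : IsConnected Ω) (hΩ_zero : (0 : EuclideanSpace ℝ (Fin N)) ∈ Ω)
    -- the optimal value function is real-valued, `C¹` and real-analytic on `Ω`
    (hvstar_finite : ∀ x ∈ Ω, OptCtrl.optimalValue f g h R x ≠ ∞)
    (hvstar_contDiff : ContDiffOn ℝ 1 (fun x => (OptCtrl.optimalValue f g h R x).toReal) Ω)
    (hvstar_analytic : AnalyticOnNhd ℝ (fun x => (OptCtrl.optimalValue f g h R x).toReal) Ω)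
    -- the candidate `v` is `C¹` and real-analytic on `Ω`
    (v : EuclideanSpace ℝ (Fin N) → ℝ)
    (hv_contDiff : ContDiffOn ℝ 1 v Ω)
    (hv_analytic : AnalyticOnNhd ℝ v Ω)
    -- `v` is positive semidefinite on `Ω`
    (hv_nonneg : ∀ x ∈ Ω, 0 ≤ v x) (hv_zero : v 0 = 0)
    -- `v` satisfies the Hamilton-Jacobi-Bellman identity on `Ω`
    (hv_HJB : ∀ x ∈ Ω,
      ⟪f x + OptCtrl.act (g x) (OptCtrl.feedback g R v x), ∇ v x⟫_ℝ + h x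
        + OptCtrl.weightedNorm R (OptCtrl.feedback g R v x) ^ 2 = 0) :
    ∀ x ∈ Ω, v x = (OptCtrl.optimalValue f g h R x).toReal := by
  have hv : OptCtrl.IsHJBSolution f g h R v Ω :=
    ⟨hΩ_open, hΩ_zero, hv_contDiff, hv_nonneg, hv_zero, hv_HJB⟩
  have hfb : ContDiffOn ℝ 1 (OptCtrl.feedback g R v) Ω :=
    hdata.contDiffOn_feedback (hv_analytic.fderiv.contDiffOn hΩ_open.uniqueDiffOn)
  refine hv_analytic.eqOn_of_preconnected_of_eventuallyEq hvstar_analytic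
    hΩ_conn.isPreconnected hΩ_zero ?_
  filter_upwards [hv.eventually_le_optimalValue hdata, hv.eventually_optimalValue_le hdata hfb,
    hΩ_open.mem_nhds hΩ_zero] with x h1 h2 hx
  rw [le_antisymm h2 h1, ENNReal.toReal_ofReal (hv_nonneg x hx)]
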